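/- Let $r\ge 2$ be a fixed integer. For an integer $n\ge 1$, an (ordered) $r$-matching of size $n$ is a partition of $[rn]=\{1,2,\dots,rn\}$ into $r$-element subsets, called its edges. Let $\mathbb{RM}^{(r)}(n)$ be an $r$-matching chosen uniformly at random among all $(rn)!/((r!)^n\,n!)$ $r$-matchings of size $n$. For an $r$-element set $e=\{i_1<i_2<\cdots<i_r\}$ of integers define its weighted length $$\ell(e)=\sum_{j=1}^{r-1}(i_r-i_j),$$ and let $$\bar L^{(r)}=\frac1n\sum_{e\in\mathbb{RM}^{(r)}(n)}\ell(e)$$ be the average weighted edge length of $\mathbb{RM}^{(r)}(n)$. Then, for every $n\ge1$, $$\mathbb{E}\,\bar L^{(r)}=\frac{r(r-1)(rn+1)}{2(r+1)},$$ and, for every function $\omega:\mathbb{N}\to\mathbb{R}$ with $\omega(n)\to\infty$ as $n\to\infty$, $$\lim_{n\to\infty}\mathbb{P}\left(\left|\bar L^{(r)}-\frac{(r-1)r^2n}{2(r+1)}\right|\le\omega(n)\sqrt n\right)=1.$$ -/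

import Mathlib

open MeasureTheory ProbabilityTheory Filter Topology

/-- An (ordered) `r`-matching of size `n`: a partition of `[rn] = {1, …, rn}` into
`r`-element subsets, called its edges. -/
def OrderedMatching (r n : ℕ) : Type :=
  {M : Finpartition (Finset.Icc 1 (r * n)) // ∀ e ∈ M.parts, e.card = r}

namespace OrderedMatching

instance (r n : ℕ) : Fintype (OrderedMatching r n) :=
  inferInstanceAs (Fintype {M : Finpartition (Finset.Icc 1 (r * n)) // ∀ e ∈ M.parts, e.card = r})

instance (r n : ℕ) : MeasurableSpace (OrderedMatching r n) := ⊤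

instance (r n : ℕ) : DiscreteMeasurableSpace (OrderedMatching r n) := ⟨fun _ => trivial⟩

/-- The finite set of edges of an `r`-matching. -/
def edges {r n : ℕ} (M : OrderedMatching r n) : Finset (Finset ℕ) := M.1.parts

/-- The law of the random `r`-matching of size `n`: the uniform probability measure on the
set of all `r`-matchings of `[rn]`. -/
noncomputable def uniform (r n : ℕ) : Measure (OrderedMatching r n) := uniformOn Set.univ

end OrderedMatching

/-- The weighted length of an edge `e = {i₁ < ⋯ < iᵣ}`, namely
`(iᵣ - i₁) + (iᵣ - i₂) + ⋯ + (iᵣ - iᵣ₋₁)`. Here `e.sup id` is the largest vertex `iᵣ`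
of `e`, and the term of the sum at `iᵣ` itself is `0`. -/
def weightedLength (e : Finset ℕ) : ℝ := ∑ i ∈ e, (((e.sup id : ℕ) : ℝ) - (i : ℝ))

/-- The average weighted edge length of an `r`-matching of size `n`, that is, the sum of the
weighted lengths of its edges divided by the number `n` of its edges. -/
noncomputable def OrderedMatching.avgLength {r n : ℕ} (M : OrderedMatching r n) : ℝ :=
  (∑ e ∈ M.edges, weightedLength e) / (n : ℝ)

/-! An edge with `r` vertices has weighted length `r · max e - ∑ e`, and the vertex sums over all
edges add up to `1 + ⋯ + rn`. So `avgLength` is a constant plus `r / n` times the sum of the centred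
edge maxima (`avgLength_eq`), and only the maxima are random.

By symmetry under permutations of `[rn]`, an edge behaves like a uniform `r`-subset and a pair of
distinct edges like a uniform pair of disjoint `r`-subsets. The mean maximum of an `r`-subset is
`r(rn+1)/(r+1)`, which gives the expectation.

For concentration, the sum of products of centred maxima over all pairs of `r`-subsets vanishes, so
the sum over disjoint pairs is minus that over intersecting pairs. The latter are a fraction at most
`r/n` of all pairs, with products at most `(rn)²` in size. Hence the sum of the `n` centred maxima
has second moment `O(n³)`, `avgLength` has mean square deviation `O(n)`, and Chebyshev's inequality
concludes. -/

/-- The order isomorphism of `Finset α` induced by a permutation of `α`. -/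
def Equiv.Perm.finsetOrderIso {α : Type*} (σ : Equiv.Perm α) : Finset α ≃o Finset α where
  toEquiv := σ.finsetCongr
  map_rel_iff' := Finset.map_subset_map

/-- Colour each point by its membership in `A`, `B`, the rest of `s`, or the complement of `s`.
Corresponding colour classes are equinumerous, so bijections between them glue to a permutation. -/
theorem Finset.exists_perm_map_eq {α : Type*} [DecidableEq α] {s A B A' B' : Finset α}
    (hA : A ⊆ s) (hB : B ⊆ s) (hA' : A' ⊆ s) (hB' : B' ⊆ s)
    (hAB : Disjoint A B) (hAB' : Disjoint A' B')
    (hcA : A.card = A'.card) (hcB : B.card = B'.card) :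
    ∃ σ : Equiv.Perm α, s.map σ.toEmbedding = s ∧ A.map σ.toEmbedding = A' ∧
      B.map σ.toEmbedding = B' := by
  let col : Finset α → Finset α → α → Fin 4 := fun X Y x =>
    if x ∈ X then 0 else if x ∈ Y then 1 else if x ∈ s then 2 else 3
  have h0 : ∀ X Y x, col X Y x = 0 ↔ x ∈ X := by
    intro X Y x; simp only [col]; split_ifs <;> simp_all
  have h1 : ∀ X Y x, Disjoint X Y → (col X Y x = 1 ↔ x ∈ Y) := by
    intro X Y x h
    have := fun h' : x ∈ X => Finset.disjoint_left.1 h h'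
    simp only [col]; split_ifs <;> simp_all
  have h2 : ∀ X Y x, X ⊆ s → Y ⊆ s → (col X Y x = 2 ↔ x ∈ s \ (X ∪ Y)) := by
    intro X Y x hX hY
    simp only [col]; split_ifs <;> simp_all
  have h3 : ∀ X Y x, X ⊆ s → Y ⊆ s → (col X Y x = 3 ↔ x ∉ s) := by
    intro X Y x hX hY
    have := fun h => Finset.mem_of_subset hX (a := x) h
    have := fun h => Finset.mem_of_subset hY (a := x) h
    simp only [col]; split_ifs <;> simp_all
  have hcard : (s \ (A ∪ B)).card = (s \ (A' ∪ B')).card := by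
    rw [Finset.card_sdiff_of_subset (Finset.union_subset hA hB),
      Finset.card_sdiff_of_subset (Finset.union_subset hA' hB'),
      Finset.card_union_of_disjoint hAB, Finset.card_union_of_disjoint hAB', hcA, hcB]
  have hfib : ∀ c, Nonempty ({x // col A B x = c} ≃ {x // col A' B' x = c}) := by
    intro c
    fin_cases c
    · exact ⟨(Equiv.subtypeEquivRight fun x => h0 A B x).trans
        ((Finset.equivOfCardEq hcA).trans (Equiv.subtypeEquivRight fun x => h0 A' B' x).symm)⟩
    · exact ⟨(Equiv.subtypeEquivRight fun x => h1 A B x hAB).trans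
        ((Finset.equivOfCardEq hcB).trans
          (Equiv.subtypeEquivRight fun x => h1 A' B' x hAB').symm)⟩
    · exact ⟨(Equiv.subtypeEquivRight fun x => h2 A B x hA hB).trans
        ((Finset.equivOfCardEq hcard).trans
          (Equiv.subtypeEquivRight fun x => h2 A' B' x hA' hB').symm)⟩
    · exact ⟨(Equiv.subtypeEquivRight fun x => h3 A B x hA hB).trans
        (Equiv.subtypeEquivRight fun x => h3 A' B' x hA' hB').symm⟩
  let e := fun c => (hfib c).some
  let σ : Equiv.Perm α := Equiv.ofFiberEquiv e
  have hσ : ∀ x, col A' B' (σ x) = col A B x := fun x => Equiv.ofFiberEquiv_map e x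
  have key : ∀ X Y : Finset α, (∀ x, σ x ∈ Y ↔ x ∈ X) → X.map σ.toEmbedding = Y := by
    intro X Y h
    ext y
    obtain ⟨x, rfl⟩ := σ.surjective y
    simp [h]
  refine ⟨σ, key _ _ fun x => ?_, key _ _ fun x => ?_, key _ _ fun x => ?_⟩
  · rw [← not_iff_not, ← h3 A B x hA hB, ← h3 A' B' _ hA' hB', hσ]
  · rw [← h0 A B, ← h0 A' B', hσ]
  · rw [← h1 A B _ hAB, ← h1 A' B' _ hAB', hσ]

/-! ### Matchings and their symmetry under relabelling -/

namespace OrderedMatching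

variable {r n : ℕ}

/-- The `r`-element subsets of `[rn]`. -/
def possibleEdges (r n : ℕ) : Finset (Finset ℕ) := (Finset.Icc 1 (r * n)).powersetCard r

/-- Relabel the vertices of a matching by a permutation preserving `[rn]`. -/
def relabel (σ : Equiv.Perm ℕ)
    (hσ : (Finset.Icc 1 (r * n)).map σ.toEmbedding = Finset.Icc 1 (r * n))
    (M : OrderedMatching r n) : OrderedMatching r n :=
  ⟨(M.1.map σ.finsetOrderIso).copy hσ, by
    intro e he
    obtain ⟨a, ha, rfl⟩ := Finset.mem_map.1 he
    exact (Finset.card_map _).trans (M.2 a ha)⟩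

theorem edges_relabel (σ : Equiv.Perm ℕ)
    (hσ : (Finset.Icc 1 (r * n)).map σ.toEmbedding = Finset.Icc 1 (r * n))
    (M : OrderedMatching r n) :
    (relabel σ hσ M).edges = M.edges.map σ.finsetOrderIso.toEquiv.toEmbedding := rfl

theorem edges_injective : Function.Injective (edges : OrderedMatching r n → _) := by
  intro M M' h
  exact Subtype.ext (Finpartition.ext h)

theorem relabel_injective (σ : Equiv.Perm ℕ)
    (hσ : (Finset.Icc 1 (r * n)).map σ.toEmbedding = Finset.Icc 1 (r * n)) :
    Function.Injective (relabel σ hσ : OrderedMatching r n → OrderedMatching r n) := by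
  intro M M' h
  have h' := congrArg edges h
  rw [edges_relabel, edges_relabel] at h'
  exact edges_injective (Finset.map_injective _ h')

theorem map_mem_edges_relabel {σ : Equiv.Perm ℕ}
    {hσ : (Finset.Icc 1 (r * n)).map σ.toEmbedding = Finset.Icc 1 (r * n)}
    {M : OrderedMatching r n} {e : Finset ℕ} (he : e ∈ M.edges) :
    e.map σ.toEmbedding ∈ (relabel σ hσ M).edges := by
  rw [edges_relabel]
  exact Finset.mem_map_of_mem _ he

theorem edges_subset_possibleEdges (M : OrderedMatching r n) : M.edges ⊆ possibleEdges r n := by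
  intro e he
  exact Finset.mem_powersetCard.2 ⟨M.1.le he, M.2 e he⟩

theorem card_edges (hr : r ≠ 0) (M : OrderedMatching r n) : M.edges.card = n := by
  have h := M.1.sum_card_parts
  rw [Finset.sum_congr rfl M.2, Finset.sum_const, Nat.card_Icc, smul_eq_mul,
    Nat.add_sub_cancel, mul_comm] at h
  exact Nat.eq_of_mul_eq_mul_left (Nat.pos_of_ne_zero hr) h

theorem sum_sum_edges {f : ℕ → ℝ} (M : OrderedMatching r n) :
    ∑ e ∈ M.edges, ∑ i ∈ e, f i = ∑ i ∈ Finset.Icc 1 (r * n), f i := by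
  have h := Finset.sum_biUnion (s := M.1.parts) (t := id) (f := f) M.1.disjoint
  rw [M.1.biUnion_parts] at h
  exact h.symm

theorem disjoint_of_mem_edges {M : OrderedMatching r n} {A B : Finset ℕ} (hA : A ∈ M.edges)
    (hB : B ∈ M.edges) (h : A ≠ B) : Disjoint A B := M.1.disjoint hA hB h

instance [NeZero r] : Nonempty (OrderedMatching r n) := by
  rcases Nat.eq_zero_or_pos n with rfl | hn
  · refine ⟨⟨(⊥ : Finpartition (Finset.Icc 1 (r * 0))), fun e he => ?_⟩⟩
    simp at he
  obtain ⟨P, hP, hc⟩ := Finpartition.exists_equipartition_card_eq (Finset.Icc 1 (r * n)) hn.ne'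
    (by simpa using Nat.le_mul_of_pos_left n (NeZero.pos r))
  -- Parts of an equipartition have at least the floor of the average size, here exactly `r`. Since
  -- the sizes sum to `rn`, none can exceed `r`.
  have hle : ∀ e ∈ P.parts, r ≤ e.card := by
    intro e he
    have := hP.average_le_card_part he
    rwa [hc, Nat.card_Icc, Nat.add_sub_cancel, Nat.mul_div_cancel _ hn] at this
  refine ⟨⟨P, fun e he => ((Finset.sum_eq_sum_iff_of_le hle).1 ?_ e he).symm⟩⟩
  rw [P.sum_card_parts, Finset.sum_const, hc, Nat.card_Icc, smul_eq_mul]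
  simp [mul_comm]

/-- The number of matchings containing both `A` and `B` as edges. -/
def countContaining (r n : ℕ) (A B : Finset ℕ) : ℕ :=
  (Finset.univ.filter fun M : OrderedMatching r n => A ∈ M.edges ∧ B ∈ M.edges).card

/-- Relabelling is injective. Using this bound for permutations in both directions yields equality
of counts. -/
theorem countContaining_map_le (σ : Equiv.Perm ℕ)
    (hσ : (Finset.Icc 1 (r * n)).map σ.toEmbedding = Finset.Icc 1 (r * n)) (A B : Finset ℕ) :
    countContaining r n A B ≤
      countContaining r n (A.map σ.toEmbedding) (B.map σ.toEmbedding) := by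
  refine Finset.card_le_card_of_injOn (relabel σ hσ) ?_ (relabel_injective σ hσ).injOn
  intro M hM
  simp only [Finset.coe_filter, Finset.mem_univ, true_and, Set.mem_ofPred_eq] at hM ⊢
  exact ⟨map_mem_edges_relabel hM.1, map_mem_edges_relabel hM.2⟩

theorem countContaining_eq_of_disjoint {A B A' B' : Finset ℕ} (hA : A ∈ possibleEdges r n)
    (hB : B ∈ possibleEdges r n) (hA' : A' ∈ possibleEdges r n) (hB' : B' ∈ possibleEdges r n)
    (hAB : Disjoint A B) (hAB' : Disjoint A' B') :
    countContaining r n A B = countContaining r n A' B' := by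
  rw [possibleEdges, Finset.mem_powersetCard] at hA hB hA' hB'
  apply le_antisymm
  · obtain ⟨σ, hσ, rfl, rfl⟩ := Finset.exists_perm_map_eq hA.1 hB.1 hA'.1 hB'.1 hAB hAB'
      (hA.2.trans hA'.2.symm) (hB.2.trans hB'.2.symm)
    exact countContaining_map_le σ hσ A B
  · obtain ⟨σ, hσ, rfl, rfl⟩ := Finset.exists_perm_map_eq hA'.1 hB'.1 hA.1 hB.1 hAB' hAB
      (hA'.2.trans hA.2.symm) (hB'.2.trans hB.2.symm)
    exact countContaining_map_le σ hσ A' B'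

theorem countContaining_self_eq {A A' : Finset ℕ} (hA : A ∈ possibleEdges r n)
    (hA' : A' ∈ possibleEdges r n) :
    countContaining r n A A = countContaining r n A' A' := by
  rw [possibleEdges, Finset.mem_powersetCard] at hA hA'
  apply le_antisymm
  · obtain ⟨σ, hσ, rfl, -⟩ := Finset.exists_perm_map_eq hA.1 (Finset.empty_subset _) hA'.1
      (Finset.empty_subset _) (Finset.disjoint_empty_right _) (Finset.disjoint_empty_right _)
      (hA.2.trans hA'.2.symm) rfl
    exact countContaining_map_le σ hσ A A
  · obtain ⟨σ, hσ, rfl, -⟩ := Finset.exists_perm_map_eq hA'.1 (Finset.empty_subset _) hA.1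
      (Finset.empty_subset _) (Finset.disjoint_empty_right _) (Finset.disjoint_empty_right _)
      (hA'.2.trans hA.2.symm) rfl
    exact countContaining_map_le σ hσ A' A'

/-! ### Double counting over edges and pairs of edges -/

/-- Ordered pairs of disjoint `r`-element subsets of `[rn]`. -/
def disjointPairs (r n : ℕ) : Finset (Finset ℕ × Finset ℕ) :=
  (possibleEdges r n ×ˢ possibleEdges r n).filter fun p => Disjoint p.1 p.2

theorem sum_sum_edges_eq_sum_possibleEdges (f : Finset ℕ → ℝ) :
    ∑ M : OrderedMatching r n, ∑ e ∈ M.edges, f e =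
      ∑ A ∈ possibleEdges r n, (countContaining r n A A : ℝ) * f A := by
  have h : ∀ M : OrderedMatching r n,
      ∑ e ∈ M.edges, f e = ∑ A ∈ possibleEdges r n, if A ∈ M.edges then f A else 0 := by
    intro M
    rw [← Finset.sum_filter, Finset.filter_mem_eq_inter,
      Finset.inter_eq_right.2 M.edges_subset_possibleEdges]
  simp_rw [h]
  rw [Finset.sum_comm]
  refine Finset.sum_congr rfl fun A _ => ?_
  rw [← Finset.sum_filter, Finset.sum_const, nsmul_eq_mul, countContaining]
  simp

theorem sum_sum_offDiag_eq_sum_disjointPairs (hr : r ≠ 0) (F : Finset ℕ × Finset ℕ → ℝ) :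
    ∑ M : OrderedMatching r n, ∑ p ∈ M.edges.offDiag, F p =
      ∑ p ∈ disjointPairs r n, (countContaining r n p.1 p.2 : ℝ) * F p := by
  have h : ∀ M : OrderedMatching r n, ∑ p ∈ M.edges.offDiag, F p =
      ∑ p ∈ disjointPairs r n, if p.1 ∈ M.edges ∧ p.2 ∈ M.edges then F p else 0 := by
    intro M
    rw [← Finset.sum_filter]
    refine Finset.sum_congr (Finset.ext fun p => ?_) fun _ _ => rfl
    simp only [Finset.mem_offDiag, disjointPairs, Finset.mem_filter, Finset.mem_product]
    constructor
    · rintro ⟨h1, h2, h3⟩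
      exact ⟨⟨⟨M.edges_subset_possibleEdges h1, M.edges_subset_possibleEdges h2⟩,
        disjoint_of_mem_edges h1 h2 h3⟩, h1, h2⟩
    · rintro ⟨⟨-, h3⟩, h1, h2⟩
      refine ⟨h1, h2, fun heq => hr ?_⟩
      rw [← heq, disjoint_self] at h3
      rw [← M.2 _ h1, h3]
      rfl
  simp_rw [h]
  rw [Finset.sum_comm]
  refine Finset.sum_congr rfl fun A _ => ?_
  rw [← Finset.sum_filter, Finset.sum_const, nsmul_eq_mul, countContaining]

/-- The common value of `c` never has to be computed: the factor with `* 1` is the same double count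
for the constant function `1`, known from the number of edges. -/
theorem sum_mul_sum_eq_of_const {α : Type*} {s : Finset α} {c : α → ℕ}
    (hc : ∀ a ∈ s, ∀ b ∈ s, c a = c b) (f : α → ℝ) :
    (s.card : ℝ) * ∑ a ∈ s, (c a : ℝ) * f a = (∑ a ∈ s, (c a : ℝ) * 1) * ∑ a ∈ s, f a := by
  rcases s.eq_empty_or_nonempty with rfl | ⟨b, hb⟩
  · simp
  have h : ∀ g : α → ℝ, ∑ a ∈ s, (c a : ℝ) * g a = (c b : ℝ) * ∑ a ∈ s, g a := by
    intro g
    rw [Finset.mul_sum]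
    exact Finset.sum_congr rfl fun a ha => by rw [hc a ha b hb]
  rw [h, h]
  simp
  ring

theorem card_mul_sum_sum_edges (hr : r ≠ 0) (f : Finset ℕ → ℝ) :
    ((possibleEdges r n).card : ℝ) * ∑ M : OrderedMatching r n, ∑ e ∈ M.edges, f e =
      Fintype.card (OrderedMatching r n) * n * ∑ A ∈ possibleEdges r n, f A := by
  rw [sum_sum_edges_eq_sum_possibleEdges, sum_mul_sum_eq_of_const
    (c := fun A => countContaining r n A A) fun a ha b hb => countContaining_self_eq ha hb,
    ← sum_sum_edges_eq_sum_possibleEdges]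
  simp [card_edges hr]

theorem card_mul_sum_sum_offDiag (hr : r ≠ 0) (F : Finset ℕ × Finset ℕ → ℝ) :
    ((disjointPairs r n).card : ℝ) * ∑ M : OrderedMatching r n, ∑ p ∈ M.edges.offDiag, F p =
      Fintype.card (OrderedMatching r n) * (n * n - n : ℝ) * ∑ p ∈ disjointPairs r n, F p := by
  rw [sum_sum_offDiag_eq_sum_disjointPairs hr, sum_mul_sum_eq_of_const
    (c := fun p : Finset ℕ × Finset ℕ => countContaining r n p.1 p.2),
    ← sum_sum_offDiag_eq_sum_disjointPairs hr]
  · simp [Finset.offDiag_card, card_edges hr, Nat.cast_sub (Nat.le_mul_self n), mul_sub]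
  · intro a ha b hb
    simp only [disjointPairs, Finset.mem_filter, Finset.mem_product] at ha hb
    exact countContaining_eq_of_disjoint ha.1.1 ha.1.2 hb.1.1 hb.1.2 ha.2 hb.2

end OrderedMatching

/-! ### Mean of the maximum and the expectation -/

theorem Finset.sum_sup_powersetCard_Icc (N k : ℕ) :
    ∑ A ∈ (Finset.Icc 1 N).powersetCard (k + 1), A.sup id =
      (k + 1) * (N + 1).choose (k + 2) := by
  induction N with
  | zero =>
    rw [Nat.choose_eq_zero_of_lt (by omega : 0 + 1 < k + 2),
      Finset.powersetCard_eq_empty.2 (by simp)]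
    simp
  | succ N ih =>
    have hnot : N + 1 ∉ Finset.Icc 1 N := by simp
    have hins : Finset.Icc 1 (N + 1) = insert (N + 1) (Finset.Icc 1 N) := by
      ext; simp; omega
    rw [hins, Finset.powersetCard_succ_insert hnot, Finset.sum_union, ih, Finset.sum_image]
    -- The `N.choose k` sets containing `N + 1` have maximum `N + 1`; absorption and Pascal's rule
    -- then close the induction.
    · have h : ∀ A ∈ (Finset.Icc 1 N).powersetCard k, (insert (N + 1) A).sup id = N + 1 := by
        intro A hA
        rw [Finset.sup_insert, id, sup_eq_left]
        refine Finset.sup_le fun x hx => ?_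
        have := Finset.mem_Icc.1 (Finset.mem_of_subset (Finset.mem_powersetCard.1 hA).1 hx)
        simp only [id]
        omega
      rw [Finset.sum_congr rfl h, Finset.sum_const, Finset.card_powersetCard, Nat.card_Icc,
        smul_eq_mul, Nat.add_sub_cancel, Nat.choose_succ_succ' (N + 1) (k + 1),
        mul_comm (N.choose k), Nat.add_one_mul_choose_eq]
      ring
    · intro A hA B hB hAB
      have hA' : N + 1 ∉ A := fun h => hnot ((Finset.mem_powersetCard.1 hA).1 h)
      have hB' : N + 1 ∉ B := fun h => hnot ((Finset.mem_powersetCard.1 hB).1 h)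
      rw [← Finset.erase_insert hA', ← Finset.erase_insert hB']
      exact congrArg (fun X => X.erase (N + 1)) hAB
    · rw [Finset.disjoint_left]
      intro A hA hA'
      obtain ⟨B, -, rfl⟩ := Finset.mem_image.1 hA'
      exact hnot ((Finset.mem_powersetCard.1 hA).1 (Finset.mem_insert_self _ _))

namespace OrderedMatching

variable {r n : ℕ}

theorem card_possibleEdges : (possibleEdges r n).card = (r * n).choose r := by
  simp [possibleEdges]

/-- The largest vertex of an edge, centred at the mean over all `r`-element subsets of `[rn]`. -/
noncomputable def centredMax (r n : ℕ) (A : Finset ℕ) : ℝ :=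
  ((A.sup id : ℕ) : ℝ) - (r : ℝ) * ((r : ℝ) * n + 1) / (r + 1)

theorem sum_centredMax (hr : r ≠ 0) : ∑ A ∈ possibleEdges r n, centredMax r n A = 0 := by
  obtain ⟨k, rfl⟩ := Nat.exists_eq_succ_of_ne_zero hr
  have h := Finset.sum_sup_powersetCard_Icc ((k + 1) * n) k
  have h2 := Nat.add_one_mul_choose_eq ((k + 1) * n) (k + 1)
  have h' : (∑ A ∈ possibleEdges (k + 1) n, ((A.sup id : ℕ) : ℝ)) =
      (k + 1) * (((k + 1) * n + 1).choose (k + 2) : ℝ) := by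
    exact_mod_cast h
  have h2' : (((k : ℝ) + 1) * n + 1) * (((k + 1) * n).choose (k + 1) : ℝ) =
      (((k + 1) * n + 1).choose (k + 2) : ℝ) * (k + 2) := by
    exact_mod_cast h2
  simp only [centredMax, Finset.sum_sub_distrib, Nat.succ_eq_add_one, Finset.sum_const,
    nsmul_eq_mul, card_possibleEdges]
  rw [h']
  push_cast
  have : (k : ℝ) + 1 + 1 ≠ 0 := by positivity
  field_simp
  linear_combination (-((k : ℝ) + 1)) * h2'

theorem abs_centredMax_le (hn : 1 ≤ n) {A : Finset ℕ} (hA : A ∈ possibleEdges r n) :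
    |centredMax r n A| ≤ (r : ℝ) * n := by
  have h1 : A.sup id ≤ r * n := by
    refine Finset.sup_le fun x hx => ?_
    exact (Finset.mem_Icc.1 (Finset.mem_of_subset (Finset.mem_powersetCard.1 hA).1 hx)).2
  have h1' : ((A.sup id : ℕ) : ℝ) ≤ (r : ℝ) * n := by exact_mod_cast h1
  have h2 : (r : ℝ) * ((r : ℝ) * n + 1) / (r + 1) ≤ (r : ℝ) * n := by
    have : (1 : ℝ) ≤ n := by exact_mod_cast hn
    rw [div_le_iff₀ (by positivity)]
    nlinarith [(Nat.cast_nonneg r : (0 : ℝ) ≤ r)]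
  have h3 : 0 ≤ (r : ℝ) * ((r : ℝ) * n + 1) / (r + 1) := by positivity
  have h4 : (0 : ℝ) ≤ ((A.sup id : ℕ) : ℝ) := Nat.cast_nonneg _
  rw [centredMax, abs_le]
  constructor <;> linarith

theorem avgLength_eq (hr : r ≠ 0) (hn : n ≠ 0) (M : OrderedMatching r n) :
    M.avgLength = (r : ℝ) * ((r : ℝ) - 1) * ((r : ℝ) * n + 1) / (2 * ((r : ℝ) + 1)) +
      r / n * ∑ e ∈ M.edges, centredMax r n e := by
  have h1 : ∑ e ∈ M.edges, weightedLength e =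
      r * (∑ e ∈ M.edges, ((e.sup id : ℕ) : ℝ)) - (r : ℝ) * n * (r * n + 1) / 2 := by
    have hs : ∑ i ∈ Finset.Icc 1 (r * n), (i : ℝ) = (r : ℝ) * n * (r * n + 1) / 2 := by
      have : ∀ N : ℕ, ∑ i ∈ Finset.Icc 1 N, (i : ℝ) = (N : ℝ) * (N + 1) / 2 := by
        intro N
        induction N with
        | zero => simp
        | succ N ih =>
          rw [Finset.sum_Icc_succ_top (by omega), ih]
          push_cast
          ring
      rw [this]
      push_cast
      ring
    rw [← hs, ← M.sum_sum_edges, Finset.mul_sum, ← Finset.sum_sub_distrib]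
    refine Finset.sum_congr rfl fun e he => ?_
    rw [weightedLength, Finset.sum_sub_distrib, Finset.sum_const, nsmul_eq_mul, M.2 e he]
  have hn' : (n : ℝ) ≠ 0 := by exact_mod_cast hn
  have hr' : (r : ℝ) + 1 ≠ 0 := by positivity
  simp only [avgLength, h1, centredMax, Finset.sum_sub_distrib, Finset.sum_const, card_edges hr,
    nsmul_eq_mul]
  field_simp
  ring

instance [NeZero r] : IsProbabilityMeasure (uniform r n) :=
  inferInstanceAs (IsProbabilityMeasure (uniformOn Set.univ))

theorem integral_uniform [NeZero r] (f : OrderedMatching r n → ℝ) :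
    ∫ M, f M ∂(uniform r n) = (∑ M, f M) / Fintype.card (OrderedMatching r n) := by
  rw [integral_fintype .of_finite, Finset.sum_div]
  refine Finset.sum_congr rfl fun M _ => ?_
  rw [uniform, measureReal_def, uniformOn_univ, Measure.count_singleton]
  simp [div_eq_inv_mul]

theorem sum_sum_centredMax (hr : r ≠ 0) (hn : n ≠ 0) :
    ∑ M : OrderedMatching r n, ∑ e ∈ M.edges, centredMax r n e = 0 := by
  have h := card_mul_sum_sum_edges (n := n) hr (centredMax r n)
  rw [sum_centredMax hr, mul_zero, mul_eq_zero, card_possibleEdges] at h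
  refine h.resolve_left ?_
  exact_mod_cast (Nat.choose_pos (Nat.le_mul_of_pos_right r (Nat.pos_of_ne_zero hn))).ne'

theorem integral_avgLength (hr : r ≠ 0) (hn : n ≠ 0) :
    ∫ M, M.avgLength ∂(uniform r n) =
      (r : ℝ) * ((r : ℝ) - 1) * ((r : ℝ) * n + 1) / (2 * ((r : ℝ) + 1)) := by
  have : NeZero r := ⟨hr⟩
  have hc : (Fintype.card (OrderedMatching r n) : ℝ) ≠ 0 := by
    exact_mod_cast Fintype.card_ne_zero
  rw [integral_uniform]
  simp_rw [avgLength_eq hr hn]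
  rw [Finset.sum_add_distrib, ← Finset.mul_sum, sum_sum_centredMax hr hn]
  simp only [Finset.sum_const, Finset.card_univ, nsmul_eq_mul, mul_zero, add_zero]
  exact mul_div_cancel_left₀ _ hc

/-! ### Second moment -/

/-- Ordered pairs of intersecting `r`-element subsets of `[rn]`. -/
def intersectingPairs (r n : ℕ) : Finset (Finset ℕ × Finset ℕ) :=
  (possibleEdges r n ×ˢ possibleEdges r n).filter fun p => ¬ Disjoint p.1 p.2

theorem card_disjointPairs_add_card_intersectingPairs :
    (disjointPairs r n).card + (intersectingPairs r n).card =
      (possibleEdges r n).card ^ 2 := by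
  rw [disjointPairs, intersectingPairs, Finset.card_filter_add_card_filter_not,
    Finset.card_product, sq]

/-- Union bound over a common vertex: each of the `rn` vertices lies in `(rn-1).choose (r-1)`
possible edges, a fraction `r/(rn)` of them all. -/
theorem mul_card_intersectingPairs_le (hr : r ≠ 0) :
    r * n * (intersectingPairs r n).card ≤ r ^ 2 * (possibleEdges r n).card ^ 2 := by
  rcases Nat.eq_zero_or_pos n with rfl | hn
  · simp
  have hN : 1 ≤ r * n := Nat.mul_pos (Nat.pos_of_ne_zero hr) hn
  have hdeg : ∀ x ∈ Finset.Icc 1 (r * n),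
      ((possibleEdges r n).filter (x ∈ ·)).card = (r * n - 1).choose (r - 1) := by
    intro x hx
    have h := Finset.card_filter_powersetCard_subset {x} (Finset.Icc 1 (r * n)) r
      (by simpa using hx) (by simpa using Nat.one_le_iff_ne_zero.2 hr)
    simpa [possibleEdges] using h
  have hsub : intersectingPairs r n ⊆ (Finset.Icc 1 (r * n)).biUnion fun x =>
      (possibleEdges r n).filter (x ∈ ·) ×ˢ (possibleEdges r n).filter (x ∈ ·) := by
    rintro ⟨A, B⟩ h
    simp only [intersectingPairs, Finset.mem_filter, Finset.mem_product,
      Finset.not_disjoint_iff] at h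
    obtain ⟨⟨hA, hB⟩, x, hxA, hxB⟩ := h
    simp only [Finset.mem_biUnion, Finset.mem_product, Finset.mem_filter]
    exact ⟨x, Finset.mem_of_subset (Finset.mem_powersetCard.1 hA).1 hxA, ⟨hA, hxA⟩, hB, hxB⟩
  have hle : (intersectingPairs r n).card ≤ r * n * (r * n - 1).choose (r - 1) ^ 2 := by
    refine (Finset.card_le_card hsub).trans (Finset.card_biUnion_le.trans_eq ?_)
    rw [Finset.sum_congr rfl fun x hx => by rw [Finset.card_product, hdeg x hx, ← sq],
      Finset.sum_const, Nat.card_Icc, smul_eq_mul, Nat.add_sub_cancel]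
  have hch : r * n * (r * n - 1).choose (r - 1) = (r * n).choose r * r := by
    have h := Nat.add_one_mul_choose_eq (r * n - 1) (r - 1)
    rwa [Nat.sub_add_cancel hN, Nat.sub_add_cancel (Nat.pos_of_ne_zero hr)] at h
  calc r * n * (intersectingPairs r n).card
      ≤ r * n * (r * n * (r * n - 1).choose (r - 1) ^ 2) := Nat.mul_le_mul_left _ hle
    _ = (r * n * (r * n - 1).choose (r - 1)) ^ 2 := by ring
    _ = r ^ 2 * (possibleEdges r n).card ^ 2 := by rw [hch, card_possibleEdges]; ring

theorem sum_disjointPairs_centredMax_le (hr : r ≠ 0) (hn : 2 * r ≤ n) :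
    ∑ p ∈ disjointPairs r n, centredMax r n p.1 * centredMax r n p.2 ≤
      2 * (r : ℝ) ^ 3 * n * (disjointPairs r n).card := by
  have hn1 : 1 ≤ n := by omega
  have hI : (r : ℝ) * n * (intersectingPairs r n).card ≤
      (r : ℝ) ^ 2 * ((possibleEdges r n).card : ℝ) ^ 2 := by
    exact_mod_cast mul_card_intersectingPairs_le (n := n) hr
  have hDI : ((disjointPairs r n).card : ℝ) + (intersectingPairs r n).card =
      ((possibleEdges r n).card : ℝ) ^ 2 := by
    exact_mod_cast card_disjointPairs_add_card_intersectingPairs (r := r) (n := n)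
  have hzero : ∑ p ∈ disjointPairs r n, centredMax r n p.1 * centredMax r n p.2 +
      ∑ p ∈ intersectingPairs r n, centredMax r n p.1 * centredMax r n p.2 = 0 := by
    rw [disjointPairs, intersectingPairs, Finset.sum_filter_add_sum_filter_not,
      Finset.sum_product, ← Finset.sum_mul_sum, sum_centredMax hr, zero_mul]
  have hlow : -((r : ℝ) ^ 2 * n ^ 2 * (intersectingPairs r n).card) ≤
      ∑ p ∈ intersectingPairs r n, centredMax r n p.1 * centredMax r n p.2 := by
    have h : ∀ p ∈ intersectingPairs r n, -((r : ℝ) ^ 2 * n ^ 2) ≤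
        centredMax r n p.1 * centredMax r n p.2 := by
      intro p hp
      have hp' := Finset.mem_product.1 (Finset.mem_filter.1 hp).1
      have h1 := mul_le_mul (abs_centredMax_le hn1 hp'.1) (abs_centredMax_le hn1 hp'.2)
        (abs_nonneg _) (by positivity)
      rw [← abs_mul] at h1
      have h2 := (abs_le.1 h1).1
      linarith
    have := Finset.card_nsmul_le_sum _ _ _ h
    rw [nsmul_eq_mul] at this
    linarith
  have hr0 : (0 : ℝ) < r := by exact_mod_cast Nat.pos_of_ne_zero hr
  have hn' : 2 * (r : ℝ) ≤ n := by exact_mod_cast hn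
  have hI0 : (0 : ℝ) ≤ (intersectingPairs r n).card := Nat.cast_nonneg _
  -- The assumption `2r ≤ n` makes at most half of all pairs intersecting, so disjoint pairs form at
  -- least half; hence the factor 2 in the bound.
  have hhalf : 2 * ((intersectingPairs r n).card : ℝ) ≤ ((possibleEdges r n).card : ℝ) ^ 2 := by
    have h1 : (r : ℝ) * (2 * r) * (intersectingPairs r n).card ≤
        (r : ℝ) * n * (intersectingPairs r n).card := by gcongr
    have h2 : (r : ℝ) ^ 2 * (2 * ((intersectingPairs r n).card : ℝ)) ≤
        (r : ℝ) ^ 2 * ((possibleEdges r n).card : ℝ) ^ 2 := by linarith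
    exact le_of_mul_le_mul_left h2 (by positivity)
  have hCD : ((possibleEdges r n).card : ℝ) ^ 2 ≤ 2 * (disjointPairs r n).card := by linarith
  calc ∑ p ∈ disjointPairs r n, centredMax r n p.1 * centredMax r n p.2
      ≤ (r : ℝ) * n * ((r : ℝ) * n * (intersectingPairs r n).card) := by linarith
    _ ≤ (r : ℝ) * n * ((r : ℝ) ^ 2 * (2 * (disjointPairs r n).card)) := by
        refine mul_le_mul_of_nonneg_left (hI.trans ?_) (by positivity)
        exact mul_le_mul_of_nonneg_left hCD (by positivity)
    _ = 2 * (r : ℝ) ^ 3 * n * (disjointPairs r n).card := by ring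

theorem sum_sum_offDiag_centredMax_le (hr : r ≠ 0) (hn : 2 * r ≤ n) :
    ∑ M : OrderedMatching r n, ∑ p ∈ M.edges.offDiag, centredMax r n p.1 * centredMax r n p.2 ≤
      Fintype.card (OrderedMatching r n) * (2 * (r : ℝ) ^ 3 * n ^ 3) := by
  have hn1 : (1 : ℝ) ≤ n := by exact_mod_cast (by omega : 1 ≤ n)
  have hD : (0 : ℝ) < (disjointPairs r n).card := by
    have h2 : (possibleEdges r n).Nonempty := by
      rw [← Finset.card_pos, card_possibleEdges]
      exact Nat.choose_pos (Nat.le_mul_of_pos_right r (by omega))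
    obtain ⟨A, hA⟩ := h2
    have hA' := Finset.mem_powersetCard.1 hA
    have hle : r ≤ (Finset.Icc 1 (r * n) \ A).card := by
      rw [Finset.card_sdiff_of_subset hA'.1, hA'.2, Nat.card_Icc, Nat.add_sub_cancel]
      have : r * 2 ≤ r * n := Nat.mul_le_mul_left r (by omega)
      omega
    obtain ⟨B, hB, hBc⟩ := Finset.exists_subset_card_eq hle
    refine Nat.cast_pos.2 (Finset.card_pos.2 ⟨(A, B), ?_⟩)
    refine Finset.mem_filter.2 ⟨Finset.mem_product.2 ⟨hA, Finset.mem_powersetCard.2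
      ⟨hB.trans Finset.sdiff_subset, hBc⟩⟩, ?_⟩
    exact Finset.disjoint_sdiff.mono_right hB
  refine le_of_mul_le_mul_left ?_ hD
  rw [card_mul_sum_sum_offDiag hr fun p => centredMax r n p.1 * centredMax r n p.2]
  have h1 := sum_disjointPairs_centredMax_le hr hn
  calc (Fintype.card (OrderedMatching r n) * (n * n - n : ℝ)) *
        ∑ p ∈ disjointPairs r n, centredMax r n p.1 * centredMax r n p.2
      ≤ (Fintype.card (OrderedMatching r n) * (n * n - n : ℝ)) *
        (2 * (r : ℝ) ^ 3 * n * (disjointPairs r n).card) := by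
        refine mul_le_mul_of_nonneg_left h1 (mul_nonneg (Nat.cast_nonneg _) ?_)
        nlinarith
    _ ≤ (Fintype.card (OrderedMatching r n) * (n * n : ℝ)) *
        (2 * (r : ℝ) ^ 3 * n * (disjointPairs r n).card) := by
        gcongr
        linarith
    _ = _ := by ring

theorem sum_sq_sum_centredMax_le (hr : r ≠ 0) (hn : 2 * r ≤ n) :
    ∑ M : OrderedMatching r n, (∑ e ∈ M.edges, centredMax r n e) ^ 2 ≤
      Fintype.card (OrderedMatching r n) * (((r : ℝ) ^ 2 + 2 * (r : ℝ) ^ 3) * n ^ 3) := by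
  have hsq : ∀ M : OrderedMatching r n, (∑ e ∈ M.edges, centredMax r n e) ^ 2 =
      ∑ e ∈ M.edges, centredMax r n e ^ 2 +
        ∑ p ∈ M.edges.offDiag, centredMax r n p.1 * centredMax r n p.2 := by
    intro M
    rw [sq, Finset.sum_mul_sum, ← Finset.sum_product', ← Finset.diag_union_offDiag,
      Finset.sum_union (Finset.disjoint_diag_offDiag _), Finset.sum_diag]
    simp only [sq]
  have hdiag : ∑ M : OrderedMatching r n, ∑ e ∈ M.edges, centredMax r n e ^ 2 ≤
      Fintype.card (OrderedMatching r n) * ((r : ℝ) ^ 2 * n ^ 3) := by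
    rw [← nsmul_eq_mul]
    refine Finset.sum_le_card_nsmul _ _ _ fun M _ => ?_
    have h := Finset.sum_le_card_nsmul M.edges (fun e => centredMax r n e ^ 2)
      ((r * n : ℝ) ^ 2) fun e he => sq_le_sq' ?_ ?_
    · rw [card_edges hr, nsmul_eq_mul] at h
      linarith
    · exact (abs_le.1 (abs_centredMax_le (by omega) (M.edges_subset_possibleEdges he))).1
    · exact (abs_le.1 (abs_centredMax_le (by omega) (M.edges_subset_possibleEdges he))).2
  simp_rw [hsq]
  rw [Finset.sum_add_distrib]
  have := sum_sum_offDiag_centredMax_le hr hn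
  linarith

theorem integral_sq_avgLength_sub_le (hr : r ≠ 0) (hn : 2 * r ≤ n) :
    ∫ M, (M.avgLength - ((r : ℝ) - 1) * (r : ℝ) ^ 2 * n / (2 * ((r : ℝ) + 1))) ^ 2
      ∂(uniform r n) ≤ 2 * ((r : ℝ) ^ 4 + 2 * (r : ℝ) ^ 5 + (r : ℝ) ^ 2) * n := by
  have : NeZero r := ⟨hr⟩
  have hc : (0 : ℝ) < Fintype.card (OrderedMatching r n) := by
    exact_mod_cast Fintype.card_pos
  have hr1 : (1 : ℝ) ≤ r := by exact_mod_cast Nat.one_le_iff_ne_zero.2 hr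
  have hn0 : n ≠ 0 := by omega
  have hn1 : (1 : ℝ) ≤ n := by exact_mod_cast Nat.one_le_iff_ne_zero.2 hn0
  -- `K` is the gap between the exact mean and the stated centre, from replacing `rn + 1` by `rn`.
  -- It is bounded in `n`, so it only affects the constant.
  set K : ℝ := (r : ℝ) * ((r : ℝ) - 1) / (2 * ((r : ℝ) + 1)) with hK
  have hK0 : 0 ≤ K := div_nonneg (mul_nonneg (by linarith) (by linarith)) (by linarith)
  have hKr : K ≤ r := by
    rw [hK, div_le_iff₀ (by linarith)]
    nlinarith
  have hpt : ∀ M : OrderedMatching r n,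
      (M.avgLength - ((r : ℝ) - 1) * (r : ℝ) ^ 2 * n / (2 * ((r : ℝ) + 1))) ^ 2 ≤
        2 * (r / n : ℝ) ^ 2 * (∑ e ∈ M.edges, centredMax r n e) ^ 2 + 2 * (r : ℝ) ^ 2 := by
    intro M
    have h : M.avgLength - ((r : ℝ) - 1) * (r : ℝ) ^ 2 * n / (2 * ((r : ℝ) + 1)) =
        r / n * (∑ e ∈ M.edges, centredMax r n e) + K := by
      rw [avgLength_eq hr hn0, hK]
      ring
    have hKsq : K ^ 2 ≤ (r : ℝ) ^ 2 := pow_le_pow_left₀ hK0 hKr 2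
    rw [h]
    nlinarith [add_sq_le (a := r / n * (∑ e ∈ M.edges, centredMax r n e)) (b := K)]
  rw [integral_uniform, div_le_iff₀ hc]
  refine (Finset.sum_le_sum fun M _ => hpt M).trans ?_
  rw [Finset.sum_add_distrib, ← Finset.mul_sum, Finset.sum_const, Finset.card_univ, nsmul_eq_mul]
  have h1 : 2 * (r / n : ℝ) ^ 2 *
      ∑ M : OrderedMatching r n, (∑ e ∈ M.edges, centredMax r n e) ^ 2 ≤
      2 * (r / n : ℝ) ^ 2 *
        (Fintype.card (OrderedMatching r n) * (((r : ℝ) ^ 2 + 2 * (r : ℝ) ^ 3) * n ^ 3)) :=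
    mul_le_mul_of_nonneg_left (sum_sq_sum_centredMax_le hr hn) (by positivity)
  have h2 : 2 * (r / n : ℝ) ^ 2 *
        (Fintype.card (OrderedMatching r n) * (((r : ℝ) ^ 2 + 2 * (r : ℝ) ^ 3) * n ^ 3)) =
      2 * ((r : ℝ) ^ 4 + 2 * (r : ℝ) ^ 5) * n * Fintype.card (OrderedMatching r n) := by
    field_simp
  have h3 : (Fintype.card (OrderedMatching r n) : ℝ) * (2 * (r : ℝ) ^ 2) ≤
      2 * (r : ℝ) ^ 2 * n * Fintype.card (OrderedMatching r n) := by
    have : 0 ≤ (Fintype.card (OrderedMatching r n) : ℝ) * (2 * (r : ℝ) ^ 2) := by positivity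
    nlinarith
  linarith

/-! ### Chebyshev's inequality and the conclusion -/

theorem one_sub_le_measureReal_abs_sub_le [NeZero r] (X : OrderedMatching r n → ℝ) {t : ℝ}
    (ht : 0 < t) :
    1 - (∫ M, X M ^ 2 ∂(uniform r n)) / t ^ 2 ≤ (uniform r n).real {M | |X M| ≤ t} := by
  have h1 := mul_meas_ge_le_integral_of_nonneg (μ := uniform r n) (f := fun M => X M ^ 2)
    (Eventually.of_forall fun M => sq_nonneg _) .of_finite (t ^ 2)
  have h2 : (uniform r n).real {M | |X M| ≤ t}ᶜ ≤ (uniform r n).real {M | t ^ 2 ≤ X M ^ 2} := by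
    refine measureReal_mono fun M hM => ?_
    have hM' : ¬ |X M| ≤ t := hM
    show t ^ 2 ≤ X M ^ 2
    rw [← sq_abs (X M)]
    exact pow_le_pow_left₀ ht.le (not_le.1 hM').le 2
  rw [probReal_compl_eq_one_sub (Set.toFinite _).measurableSet] at h2
  have h3 : (uniform r n).real {M | t ^ 2 ≤ X M ^ 2} ≤
      (∫ M, X M ^ 2 ∂(uniform r n)) / t ^ 2 := by
    rw [le_div_iff₀ (by positivity), mul_comm]
    exact h1
  linarith

end OrderedMatching

theorem mainTheorem5 (r : ℕ) (hr : 2 ≤ r) :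
    (∀ n : ℕ, 1 ≤ n →
      ∫ M, M.avgLength ∂(OrderedMatching.uniform r n) =
        (r : ℝ) * ((r : ℝ) - 1) * ((r : ℝ) * (n : ℝ) + 1) / (2 * ((r : ℝ) + 1))) ∧
    (∀ ω : ℕ → ℝ, Tendsto ω atTop atTop →
      Tendsto
        (fun n : ℕ => (OrderedMatching.uniform r n).real
          {M | |M.avgLength - ((r : ℝ) - 1) * (r : ℝ) ^ 2 * (n : ℝ) / (2 * ((r : ℝ) + 1))|
            ≤ ω n * √(n : ℝ)})
        atTop (𝓝 1)) := by
  have hr0 : r ≠ 0 := by omega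
  have : NeZero r := ⟨hr0⟩
  refine ⟨fun n hn => OrderedMatching.integral_avgLength hr0 (by omega), fun ω hω => ?_⟩
  set C : ℝ := 2 * ((r : ℝ) ^ 4 + 2 * (r : ℝ) ^ 5 + (r : ℝ) ^ 2)
  have hlim : Tendsto (fun n => 1 - C / ω n ^ 2) atTop (𝓝 1) := by
    have h : Tendsto (fun n => C / ω n ^ 2) atTop (𝓝 0) :=
      ((tendsto_pow_atTop two_ne_zero).comp hω).const_div_atTop C
    simpa using h.const_sub 1
  refine tendsto_of_tendsto_of_tendsto_of_le_of_le' hlim tendsto_const_nhds ?_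
    (Eventually.of_forall fun n => measureReal_le_one)
  filter_upwards [hω.eventually_gt_atTop 0, eventually_ge_atTop (2 * r)] with n hωn hn
  have hn0 : (0 : ℝ) < n := by exact_mod_cast (by omega : 0 < n)
  refine le_trans ?_ (OrderedMatching.one_sub_le_measureReal_abs_sub_le _
    (mul_pos hωn (Real.sqrt_pos.2 hn0)))
  rw [mul_pow, Real.sq_sqrt hn0.le]
  -- With `t = ω n * √n`, the second moment bound `C * n` divided by `t ^ 2` loses its factor `n`.
  have h : C / ω n ^ 2 = C * n / (ω n ^ 2 * n) := by field_simp
  rw [h]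
  gcongr
  exact OrderedMatching.integral_sq_avgLength_sub_le hr0 hn
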